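/- All algebras are finitary, a variety is a class of algebras of a fixed signature defined by identities, juxtaposition of relations denotes intersection, and for binary relations $\beta\circ_n\gamma$ denotes $\beta\circ\gamma\circ\beta\circ\cdots$ with $n$ factors (equality if $n=0$). For a variety $\mathcal V$ and $m\ge 1$, let $J_{\mathcal V}(m)$ be the least natural number $k$ such that $\alpha(\beta\circ_{m+1}\gamma)\subseteq \alpha\beta\circ_{k+1}\alpha\gamma$ holds for all congruences $\alpha,\beta,\gamma$ of every algebra in $\mathcal V$, and let $J^{\smallsmile}_{\mathcal V}(m)$ be the least natural number $k$ such that $\alpha(\beta\circ_{m+1}\gamma)\subseteq \alpha\gamma\circ_{k+1}\alpha\beta$ holds for all such congruences. The variety $\mathcal V$ is $m$-modular if $\alpha(\beta\circ\alpha\gamma\circ\beta)\subseteq\alpha\beta\circ_m\alpha\gamma$ holds for all such congruences. For $k\ge 0$, $\mathcal V$ has $k+2$ Gumm terms if there are ternary terms $p,j_1,\dots,j_{k+1}$ such that the following identities hold in $\mathcal V$: $x=p(x,z,z)$; $p(x,x,z)=j_1(x,x,z)$; $x=j_i(x,y,x)$ for $1\le i\le k+1$; $j_i(x,x,z)=j_{i+1}(x,x,z)$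 for even $i$ and $j_i(x,z,z)=j_{i+1}(x,z,z)$ for odd $i$, where $1\le i<k+1$; $j_{k+1}(x,y,z)=z$. **Theorem.** Let $\mathcal V$ be a congruence distributive variety. Then $J_{\mathcal V}(1)$, $J^{\smallsmile}_{\mathcal V}(1)$, $J_{\mathcal V}(2)$, $J^{\smallsmile}_{\mathcal V}(2)$ exist, and the following hold. 1. If $m\ge 2$ and $\mathcal V$ is $m$-modular, then $$J_{\mathcal V}(2)\le J^{\smallsmile}_{\mathcal V}(1)+2m^2-2m-2\quad\text{and}\quad J^{\smallsmile}_{\mathcal V}(2)\le J_{\mathcal V}(1)+2m^2-2m-2.$$ 2. If $k\ge 0$ and $\mathcal V$ has $k+2$ Gumm terms, then $$J_{\mathcal V}(2)\le J^{\smallsmile}_{\mathcal V}(1)+2k\quad\text{and}\quad J^{\smallsmile}_{\mathcal V}(2)\le J_{\mathcal V}(1)+2k.$$ If moreover $k\ge 1$, these bounds improve by $1$ under parity conditions: if $J^{\smallsmile}_{\mathcal V}(1)$ is odd, then $J_{\mathcal V}(2)\le J^{\smallsmile}_{\mathcal V}(1)+2k-1$; and if $J_{\mathcal V}(1)$ is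 even, then $J^{\smallsmile}_{\mathcal V}(2)\le J_{\mathcal V}(1)+2k-1$. -/

import Mathlib

universe u v

namespace UnivAlg

/-! A (finitary) signature is a first-order language `L` without relation symbols, and an algebra
of that signature is an `L`-structure. -/

/-- A congruence of the algebra `A`: an equivalence relation compatible with all operations. -/
structure Congruence (L : FirstOrder.Language.{u, v}) (A : Type u) [L.Structure A] extends Setoid A where
  compat : ∀ {n : ℕ} (f : L.Functions n) (x y : Fin n → A),
    (∀ i, r (x i) (y i)) → r (FirstOrder.Language.Structure.funMap f x) (FirstOrder.Language.Structure.funMap f y)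

namespace Congruence

variable {L : FirstOrder.Language.{u, v}} {A : Type u} [L.Structure A]

theorem toSetoid_injective :
    Function.Injective (Congruence.toSetoid : Congruence L A → Setoid A) := by
  rintro ⟨s, hs⟩ ⟨t, ht⟩ h
  cases h
  rfl

/-- Congruences are ordered by inclusion. -/
instance : PartialOrder (Congruence L A) :=
  PartialOrder.lift Congruence.toSetoid toSetoid_injective

instance : InfSet (Congruence L A) where
  sInf S :=
    { r := fun a b => ∀ θ ∈ S, θ.r a b
      iseqv :=
        ⟨fun a θ _ => θ.iseqv.refl a, fun h θ hθ => θ.iseqv.symm (h θ hθ),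
          fun h h' θ hθ => θ.iseqv.trans (h θ hθ) (h' θ hθ)⟩
      compat := fun f x y h θ hθ => θ.compat f x y (fun i => h i θ hθ) }

theorem isGLB_sInf (S : Set (Congruence L A)) : IsGLB S (sInf S) :=
  ⟨fun θ hθ _ _ h => h θ hθ, fun _ hb _ _ h θ hθ => hb hθ h⟩

/-- The lattice **Con**(A) of congruences of `A`; meets are intersections. -/
instance : CompleteLattice (Congruence L A) :=
  completeLatticeOfInf (Congruence L A) isGLB_sInf

end Congruence

/-- `altComp R S n` is `R ∘ S ∘ R ∘ ⋯` with `n` factors; with `0` factors it is equality. -/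
def altComp {A : Type u} (R S : A → A → Prop) : ℕ → A → A → Prop
  | 0 => Eq
  | n + 1 => Relation.Comp R (altComp S R n)

variable {L : FirstOrder.Language.{u, v}}

/-- `A` satisfies all the identities in `E`, i.e. `A` belongs to the variety (equational class)
axiomatized by `E`. An identity is a pair of terms in the variables `x₀, x₁, x₂, …`. -/
def Models (E : Set (L.Term ℕ × L.Term ℕ)) (A : Type u) [L.Structure A] : Prop :=
  ∀ e ∈ E, ∀ x : ℕ → A, e.1.realize x = e.2.realize x

/-- The variety axiomatized by `E` is congruence distributive. -/
def CongruenceDistributive (E : Set (L.Term ℕ × L.Term ℕ)) : Prop :=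
  ∀ (A : Type u) [L.Structure A], Models E A →
    ∀ α β γ : Congruence L A, α ⊓ (β ⊔ γ) = (α ⊓ β) ⊔ (α ⊓ γ)

/-- The identity `(m,k)`-dist: `α(β ∘ₘ γ) ⊆ αβ ∘ₖ αγ` for all congruences of all algebras
in the variety (juxtaposition is intersection). -/
def Dist (E : Set (L.Term ℕ × L.Term ℕ)) (m k : ℕ) : Prop :=
  ∀ (A : Type u) [L.Structure A], Models E A → ∀ α β γ : Congruence L A,
    α.r ⊓ altComp β.r γ.r m ≤ altComp (α.r ⊓ β.r) (α.r ⊓ γ.r) k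

/-- The identity `(m,k)`-dist`⌣`: `α(β ∘ₘ γ) ⊆ αγ ∘ₖ αβ`. -/
def DistConv (E : Set (L.Term ℕ × L.Term ℕ)) (m k : ℕ) : Prop :=
  ∀ (A : Type u) [L.Structure A], Models E A → ∀ α β γ : Congruence L A,
    α.r ⊓ altComp β.r γ.r m ≤ altComp (α.r ⊓ γ.r) (α.r ⊓ β.r) k

/-- The Jónsson distributivity function: the least `k` such that `(m+1,k+1)`-dist holds. -/
noncomputable def J (E : Set (L.Term ℕ × L.Term ℕ)) (m : ℕ) : ℕ :=
  sInf {k | Dist E (m + 1) (k + 1)}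

/-- The variant `J⌣`: the least `k` such that `(m+1,k+1)`-dist`⌣` holds. -/
noncomputable def JConv (E : Set (L.Term ℕ × L.Term ℕ)) (m : ℕ) : ℕ :=
  sInf {k | DistConv E (m + 1) (k + 1)}

/-- `m`-modularity: `α(β ∘ αγ ∘ β) ⊆ αβ ∘ₘ αγ` for all congruences of algebras in the variety. -/
def IsModular (E : Set (L.Term ℕ × L.Term ℕ)) (m : ℕ) : Prop :=
  ∀ (A : Type u) [L.Structure A], Models E A → ∀ α β γ : Congruence L A,
    α.r ⊓ Relation.Comp β.r (Relation.Comp (α.r ⊓ γ.r) β.r) ≤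
      altComp (α.r ⊓ β.r) (α.r ⊓ γ.r) m

/-- The variety has `k + 2` Gumm terms, i.e. ternary terms `p, j₁, …, jₖ₊₁` satisfying the
identities below (the values of `j` outside `1, …, k+1` are irrelevant). -/
def HasGummTerms (E : Set (L.Term ℕ × L.Term ℕ)) (k : ℕ) : Prop :=
  ∃ (p : L.Term (Fin 3)) (j : ℕ → L.Term (Fin 3)),
    ∀ (A : Type u) [L.Structure A], Models E A → ∀ x y z : A,
      x = p.realize ![x, z, z] ∧
      p.realize ![x, x, z] = (j 1).realize ![x, x, z] ∧
      (∀ i, 1 ≤ i → i ≤ k + 1 → x = (j i).realize ![x, y, x]) ∧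
      (∀ i, 1 ≤ i → i < k + 1 → Even i →
        (j i).realize ![x, x, z] = (j (i + 1)).realize ![x, x, z]) ∧
      (∀ i, 1 ≤ i → i < k + 1 → Odd i →
        (j i).realize ![x, z, z] = (j (i + 1)).realize ![x, z, z]) ∧
      (j (k + 1)).realize ![x, y, z] = z

end UnivAlg

/-! Everything reduces to lowering three factors to two. If `a β b γ c β d` and `a α d`, Gumm terms
give `e = j₁(a,b,d)` with `a α e` and `a (γ ∘ β) e`. The remaining `jᵢ` link `e` to `d` by `2k`
alternating factors `αγ, αβ`. Thus `α(β ∘ γ ∘ β) ⊆ α(γ ∘ β) ∘ (αγ ∘₂ₖ αβ)`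
(`HasGummTerms.exists_chain`). The value of the spectrum at 1 bounds the first block, and parity
decides whether a factor is saved at the junction.

For `m`-modular varieties, Day terms are read off a free algebra. An induction along them that
reapplies modularity (`IsDayTerms.exists_chain`) produces `k + 2` Gumm terms with `k = (m + 1)(m -
2)`, so the first claim follows from the second. All four minima exist because in a free algebra
distributivity yields a finite chain, which transfers to every algebra of the variety. -/

namespace UnivAlg

open FirstOrder FirstOrder.Language

/-! ### Alternating compositions of relations -/

section AltComp

variable {A : Type u}

theorem altComp_map {B : Type u} {R S : A → A → Prop} {R' S' : B → B → Prop} {f : A → B}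
    (hR : ∀ a b, R a b → R' (f a) (f b)) (hS : ∀ a b, S a b → S' (f a) (f b)) :
    ∀ {n : ℕ} {a b : A}, altComp R S n a b → altComp R' S' n (f a) (f b) := by
  intro n
  induction n generalizing R S R' S' with
  | zero => rintro a b rfl; rfl
  | succ n ih =>
    rintro a b ⟨c, hac, hcb⟩
    exact ⟨f c, hR _ _ hac, ih hS hR hcb⟩

theorem altComp_succ_of {R S : A → A → Prop} (hR : ∀ a, R a a) (hS : ∀ a, S a a) :
    ∀ {n : ℕ} {a b : A}, altComp R S n a b → altComp R S (n + 1) a b := by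
  intro n
  induction n generalizing R S with
  | zero => rintro a b rfl; exact ⟨a, hR a, rfl⟩
  | succ n ih =>
    rintro a b ⟨c, hac, hcb⟩
    exact ⟨c, hac, ih hS hR hcb⟩

theorem altComp_mono {R S : A → A → Prop} (hR : ∀ a, R a a) (hS : ∀ a, S a a) {n k : ℕ}
    (hnk : n ≤ k) {a b : A} (h : altComp R S n a b) : altComp R S k a b := by
  induction hnk with
  | refl => exact h
  | step _ ih => exact altComp_succ_of hR hS ih

/-- Concatenation of alternating chains whose factors fit together. -/
theorem altComp_append {R S : A → A → Prop} {n k : ℕ} {a b c : A} (h : altComp R S n a b)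
    (h' : altComp (if Even n then R else S) (if Even n then S else R) k b c) :
    altComp R S (n + k) a c := by
  induction n generalizing R S a with
  | zero => cases h; simpa using h'
  | succ n ih =>
    obtain ⟨d, had, hdb⟩ := h
    rw [show n + 1 + k = (n + k) + 1 by omega]
    refine ⟨d, had, ih hdb ?_⟩
    by_cases hn : Even n <;> simpa [Nat.even_add_one, hn] using h'

/-- Concatenation of alternating chains where the last factor of the first chain agrees with the
first factor of the second one. -/
theorem altComp_append_merge {R S : A → A → Prop} (hR : Equivalence R)
    (hS : Equivalence S) {n k : ℕ} {a b c : A} (h : altComp R S (n + 1) a b)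
    (h' : altComp (if Even n then R else S) (if Even n then S else R) (k + 1) b c) :
    altComp R S (n + 1 + k) a c := by
  induction n generalizing R S a with
  | zero =>
    obtain ⟨d, had, rfl⟩ := h
    obtain ⟨e, hde, hec⟩ := h'
    simp only [Even.zero, if_true] at hde hec
    rw [Nat.add_comm (0 + 1) k]
    exact ⟨e, hR.trans had hde, hec⟩
  | succ n ih =>
    obtain ⟨d, had, hdb⟩ := h
    rw [show n + 1 + 1 + k = (n + 1 + k) + 1 by omega]
    refine ⟨d, had, ih hS hR hdb ?_⟩
    by_cases hn : Even n <;> simpa [Nat.even_add_one, hn] using h'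

theorem altComp_append_of_equivalence {R S : A → A → Prop} (hR : Equivalence R)
    (hS : Equivalence S) {n k : ℕ} {a b c : A} (h : altComp R S n a b)
    (h' : altComp R S k b c) : altComp R S (n + k) a c := by
  by_cases hn : Even n
  · exact altComp_append h (by simpa [hn] using h')
  · obtain ⟨n, rfl⟩ : ∃ l, n = l + 1 :=
      Nat.exists_eq_succ_of_ne_zero (by rintro rfl; exact hn Even.zero)
    rw [Nat.even_add_one, not_not] at hn
    cases k with
    | zero => cases h'; exact h
    | succ k =>
      exact altComp_succ_of hR.refl hS.refl
        (altComp_append_merge hR hS h (by simpa only [hn, if_true] using h'))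

theorem altComp_swap {R S : A → A → Prop} (hS : ∀ a, S a a) {n : ℕ} {a b : A}
    (h : altComp R S n a b) : altComp S R (n + 1) a b :=
  ⟨a, hS a, h⟩

theorem altComp_symm {R S : A → A → Prop} (hR : Equivalence R) (hS : Equivalence S) {n : ℕ}
    {a b : A} (h : altComp R S n a b) : ∃ k, altComp R S k b a := by
  induction n generalizing R S a with
  | zero => cases h; exact ⟨0, rfl⟩
  | succ n ih =>
    obtain ⟨d, had, hdb⟩ := h
    obtain ⟨k, hk⟩ := ih hS hR hdb
    exact ⟨k + 1 + 1, altComp_append_of_equivalence hR hS (altComp_swap hR.refl hk)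
      ⟨a, hR.symm had, rfl⟩⟩

theorem exists_seq_of_altComp {R S : A → A → Prop} {n : ℕ} {a b : A} (h : altComp R S n a b) :
    ∃ w : ℕ → A, w 0 = a ∧ w n = b ∧ ∀ i < n,
      (Even i → R (w i) (w (i + 1))) ∧ (Odd i → S (w i) (w (i + 1))) := by
  induction n generalizing R S a with
  | zero => exact ⟨fun _ => a, rfl, h, fun i hi => absurd hi (Nat.not_lt_zero i)⟩
  | succ n ih =>
    obtain ⟨d, had, hdb⟩ := h
    obtain ⟨w, hw0, hwn, hw⟩ := ih hdb
    refine ⟨fun i => Nat.casesOn i a w, rfl, hwn, fun i hi => ?_⟩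
    cases i with
    | zero => exact ⟨fun _ => by simpa [hw0] using had, fun h => by simp at h⟩
    | succ i =>
      obtain ⟨h1, h2⟩ := hw i (by omega)
      exact ⟨fun h => h2 (by rwa [Nat.even_add_one, Nat.not_even_iff_odd] at h),
        fun h => h1 (by rwa [Nat.odd_add_one, Nat.not_odd_iff_even] at h)⟩

theorem rel_of_altComp {R S T : A → A → Prop} (hT : Equivalence T) (hR : ∀ a b, R a b → T a b)
    (hS : ∀ a b, S a b → T a b) {n : ℕ} {a b : A} (h : altComp R S n a b) : T a b := by
  induction n generalizing R S a with
  | zero => cases h; exact hT.refl _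
  | succ n ih =>
    obtain ⟨d, had, hdb⟩ := h
    exact hT.trans (hR _ _ had) (ih hS hR hdb)

end AltComp

variable {L : FirstOrder.Language.{u, v}}

/-! ### Congruences, terms and joins -/

namespace Congruence

variable {A : Type u} [L.Structure A]

theorem equivalence_inf (α β : Congruence L A) : Equivalence (α.r ⊓ β.r) :=
  ⟨fun a => ⟨α.iseqv.refl a, β.iseqv.refl a⟩,
    fun h => ⟨α.iseqv.symm h.1, β.iseqv.symm h.2⟩,
    fun h h' => ⟨α.iseqv.trans h.1 h'.1, β.iseqv.trans h.2 h'.2⟩⟩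

theorem realize_rel (θ : Congruence L A) {X : Type*} (t : L.Term X) {x y : X → A}
    (h : ∀ i, θ.r (x i) (y i)) : θ.r (t.realize x) (t.realize y) := by
  induction t with
  | var i => exact h i
  | func f ts ih => exact θ.compat f _ _ ih

theorem realize_rel_three (θ : Congruence L A) (t : L.Term (Fin 3)) {a b c a' b' c' : A}
    (ha : θ.r a a') (hb : θ.r b b') (hc : θ.r c c') :
    θ.r (t.realize ![a, b, c]) (t.realize ![a', b', c']) :=
  θ.realize_rel t fun i => by fin_cases i <;> assumption

theorem realize_rel_four (θ : Congruence L A) (t : L.Term (Fin 4)) {a b c d a' b' c' d' : A}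
    (ha : θ.r a a') (hb : θ.r b b') (hc : θ.r c c') (hd : θ.r d d') :
    θ.r (t.realize ![a, b, c, d]) (t.realize ![a', b', c', d']) :=
  θ.realize_rel t fun i => by fin_cases i <;> assumption

theorem inf_rel {α β : Congruence L A} {a b : A} (h : (α ⊓ β).r a b) : α.r a b ∧ β.r a b :=
  ⟨(inf_le_left : α ⊓ β ≤ α) h, (inf_le_right : α ⊓ β ≤ β) h⟩

theorem rel_inf {α β : Congruence L A} {a b : A} (ha : α.r a b) (hb : β.r a b) :
    (α ⊓ β).r a b := by
  let δ : Congruence L A :=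
    { r := α.r ⊓ β.r
      iseqv := equivalence_inf α β
      compat := fun f x y h =>
        ⟨α.compat f x y fun i => (h i).1, β.compat f x y fun i => (h i).2⟩ }
  have h1 : δ ≤ α := fun _ _ h => h.1
  have h2 : δ ≤ β := fun _ _ h => h.2
  exact (le_inf h1 h2 : δ ≤ α ⊓ β) (show α.r a b ∧ β.r a b from ⟨ha, hb⟩)

theorem altComp_compat (α β : Congruence L A) (k : ℕ) {n : ℕ} (f : L.Functions n)
    (x y : Fin n → A) (h : ∀ i, altComp α.r β.r k (x i) (y i)) :
    altComp α.r β.r k (Structure.funMap f x) (Structure.funMap f y) := by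
  induction k generalizing α β x with
  | zero =>
    have : x = y := funext h
    subst this; rfl
  | succ k ih =>
    choose w hw hw' using h
    exact ⟨Structure.funMap f w, α.compat f x w hw, ih β α w hw'⟩

/-- The union of all alternating compositions of two congruences, as a congruence. -/
def iUnionAltComp (α β : Congruence L A) : Congruence L A where
  r a b := ∃ n, altComp α.r β.r n a b
  iseqv :=
    ⟨fun _ => ⟨0, rfl⟩, fun ⟨_, h⟩ => altComp_symm α.iseqv β.iseqv h,
      fun ⟨_, h⟩ ⟨_, h'⟩ => ⟨_, altComp_append_of_equivalence α.iseqv β.iseqv h h'⟩⟩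
  compat := fun f x y h => by
    choose n hn using h
    -- Operations are finitary, so the chains for the arguments can be padded to a common length.
    exact ⟨Finset.univ.sup n, altComp_compat α β _ f x y fun i =>
      altComp_mono α.iseqv.refl β.iseqv.refl (Finset.le_sup (Finset.mem_univ i)) (hn i)⟩

theorem exists_altComp_of_sup {α β : Congruence L A} {a b : A} (h : (α ⊔ β).r a b) :
    ∃ n, altComp α.r β.r n a b := by
  have h1 : α ≤ iUnionAltComp α β := fun _ b h => ⟨1, b, h, rfl⟩
  have h2 : β ≤ iUnionAltComp α β := fun a b h => ⟨2, a, α.iseqv.refl a, b, h, rfl⟩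
  exact (sup_le h1 h2 : α ⊔ β ≤ iUnionAltComp α β) h

end Congruence

/-! ### Free algebras of the variety -/

variable (E : Set (L.Term ℕ × L.Term ℕ))

/-- Two terms are identified if they agree in all algebras of the variety. -/
def termSetoid (X : Type) : Setoid (L.Term X) where
  r s t := ∀ (A : Type u) [L.Structure A], Models E A → ∀ v : X → A, s.realize v = t.realize v
  iseqv := ⟨fun _ _ _ _ _ => rfl, fun h A _ hA v => (h A hA v).symm,
    fun h h' A _ hA v => (h A hA v).trans (h' A hA v)⟩

/-- The free algebra over `X` in the variety axiomatized by `E`. -/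
def Free (X : Type) : Type u := Quotient (termSetoid E X)

namespace Free

variable {E} {X : Type}

/-- The class of a term in the free algebra. -/
def mk (t : L.Term X) : Free E X := Quotient.mk (termSetoid E X) t

/-- A term representing an element of the free algebra. -/
noncomputable def rep (a : Free E X) : L.Term X := Quotient.out a

theorem mk_rep (a : Free E X) : mk a.rep = a := Quotient.out_eq a

theorem mk_eq_mk {s t : L.Term X} : (mk s : Free E X) = mk t ↔
    ∀ (A : Type u) [L.Structure A], Models E A → ∀ v : X → A, s.realize v = t.realize v :=
  Quotient.eq (r := termSetoid E X)

theorem realize_rep_mk (t : L.Term X) {A : Type u} [L.Structure A] (hA : Models E A) (v : X → A) :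
    (mk t : Free E X).rep.realize v = t.realize v :=
  mk_eq_mk.1 (mk_rep (mk t : Free E X)) A hA v

noncomputable instance : L.Structure (Free E X) where
  funMap f x := mk (Term.func f fun i => (x i).rep)
  RelMap _ _ := False

theorem realize_mk {Y : Type} (t : L.Term Y) (v : Y → L.Term X) :
    t.realize (fun i => (mk (v i) : Free E X)) = mk (t.subst v) := by
  induction t with
  | var i => rfl
  | func f ts ih =>
    refine mk_eq_mk.2 fun A _ hA w => ?_
    simp only [ih, Term.realize_func, Term.subst, realize_rep_mk _ hA]

theorem models : Models E (Free E X) := by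
  intro e he x
  have hx : x = fun i => mk (x i).rep := funext fun i => (mk_rep (x i)).symm
  rw [hx, realize_mk, realize_mk, mk_eq_mk]
  intro A _ hA v
  rw [Term.realize_subst, Term.realize_subst]
  exact hA e he _

/-- The congruence of the free algebra relating the terms that agree on all valuations
satisfying `P`. -/
def kerCong (P : ∀ {A : Type u}, (X → A) → Prop) : Congruence L (Free E X) where
  r a b := ∀ (A : Type u) [L.Structure A], Models E A → ∀ v : X → A, P v →
    a.rep.realize v = b.rep.realize v
  iseqv := ⟨fun _ _ _ _ _ _ => rfl, fun h A _ hA v hv => (h A hA v hv).symm,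
    fun h h' A _ hA v hv => (h A hA v hv).trans (h' A hA v hv)⟩
  compat := fun f x y h A _ hA v hv => by
    change (mk _ : Free E X).rep.realize v = (mk _ : Free E X).rep.realize v
    rw [realize_rep_mk _ hA, realize_rep_mk _ hA, Term.realize_func, Term.realize_func]
    congr 1
    exact funext fun i => h i A hA v hv

theorem kerCong_mk {P : ∀ {A : Type u}, (X → A) → Prop} {s t : L.Term X} :
    (kerCong (E := E) P).r (mk s) (mk t) ↔
      ∀ (A : Type u) [L.Structure A], Models E A → ∀ v : X → A, P v →
        s.realize v = t.realize v := by
  refine forall_congr' fun A => forall_congr' fun _ => forall_congr' fun hA =>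
    forall_congr' fun v => ?_
  rw [realize_rep_mk _ hA, realize_rep_mk _ hA]

theorem kerCong_var {P : ∀ {A : Type u}, (X → A) → Prop} {i j : X}
    (h : ∀ (A : Type u) (v : X → A), P v → v i = v j) :
    (kerCong (E := E) P).r (mk (Term.var i)) (mk (Term.var j)) :=
  kerCong_mk.2 fun A _ _ v hv => h A v hv

/-- Evaluation at a valuation congruent to one satisfying `P` maps `kerCong P` into the
congruence. -/
theorem rel_of_kerCong {P : ∀ {A : Type u}, (X → A) → Prop} {A : Type u} [L.Structure A]
    (hA : Models E A) (θ : Congruence L A) {v w : X → A} (hw : P w) (hvw : ∀ i, θ.r (v i) (w i))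
    {a b : Free E X} (h : (kerCong (E := E) P).r a b) :
    θ.r (a.rep.realize v) (b.rep.realize v) := by
  -- Moving from `v` to `w` and back within `θ` avoids passing to the quotient `A/θ`.
  refine θ.iseqv.trans (θ.realize_rel a.rep hvw) ?_
  rw [h A hA w hw]
  exact θ.iseqv.symm (θ.realize_rel b.rep hvw)

end Free

/-! ### Existence of the spectrum values -/

variable {E}

-- Four generators carry the generic instance of `α(β ∘ γ ∘ β)`. Distributivity puts the outer pair
-- in `αβ ∨ αγ`, hence in a chain of some length `n`. Evaluating the terms of this chain gives the
-- same `n` in every algebra.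
open Free in
theorem CongruenceDistributive.exists_dist_three (hE : CongruenceDistributive E) :
    ∃ n, Dist E 3 n := by
  let α : Congruence L (Free E (Fin 4)) := kerCong fun v => v 0 = v 3
  let β : Congruence L (Free E (Fin 4)) := kerCong fun v => v 0 = v 1 ∧ v 2 = v 3
  let γ : Congruence L (Free E (Fin 4)) := kerCong fun v => v 1 = v 2
  have hα : α.r (mk (Term.var 0)) (mk (Term.var 3)) := kerCong_var fun _ _ h => h
  have hβ : β.r (mk (Term.var 0)) (mk (Term.var 1)) := kerCong_var fun _ _ h => h.1
  have hγ : γ.r (mk (Term.var 1)) (mk (Term.var 2)) := kerCong_var fun _ _ h => h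
  have hβ' : β.r (mk (Term.var 2)) (mk (Term.var 3)) := kerCong_var fun _ _ h => h.2
  have hβl : β ≤ β ⊔ γ := le_sup_left
  have hγl : γ ≤ β ⊔ γ := le_sup_right
  have h : (α ⊓ (β ⊔ γ)).r (mk (Term.var 0)) (mk (Term.var 3)) :=
    Congruence.rel_inf hα ((β ⊔ γ).iseqv.trans (hβl hβ) ((β ⊔ γ).iseqv.trans (hγl hγ) (hβl hβ')))
  rw [hE _ models] at h
  obtain ⟨n, hn⟩ := Congruence.exists_altComp_of_sup h
  refine ⟨n, ?_⟩
  rintro A _ hA α' β' γ' a d ⟨had, b, hab, c, hbc, d, hcd, rfl⟩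
  have hα' : ∀ s t, α.r s t → α'.r (s.rep.realize ![a, b, c, d]) (t.rep.realize ![a, b, c, d]) :=
    fun s t => rel_of_kerCong hA α' (w := ![a, b, c, a]) rfl fun i => by
      fin_cases i
      exacts [α'.iseqv.refl _, α'.iseqv.refl _, α'.iseqv.refl _, α'.iseqv.symm had]
  have hβ' : ∀ s t, β.r s t → β'.r (s.rep.realize ![a, b, c, d]) (t.rep.realize ![a, b, c, d]) :=
    fun s t => rel_of_kerCong hA β' (w := ![a, a, c, c]) ⟨rfl, rfl⟩ fun i => by
      fin_cases i
      exacts [β'.iseqv.refl _, β'.iseqv.symm hab, β'.iseqv.refl _, β'.iseqv.symm hcd]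
  have hγ' : ∀ s t, γ.r s t → γ'.r (s.rep.realize ![a, b, c, d]) (t.rep.realize ![a, b, c, d]) :=
    fun s t => rel_of_kerCong hA γ' (w := ![a, b, b, d]) rfl fun i => by
      fin_cases i
      exacts [γ'.iseqv.refl _, γ'.iseqv.refl _, γ'.iseqv.symm hbc, γ'.iseqv.refl _]
  have key := altComp_map (R' := α'.r ⊓ β'.r) (S' := α'.r ⊓ γ'.r)
    (f := fun s : Free E (Fin 4) => s.rep.realize ![a, b, c, d])
    (fun s t h => ⟨hα' s t (Congruence.inf_rel h).1, hβ' s t (Congruence.inf_rel h).2⟩)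
    (fun s t h => ⟨hα' s t (Congruence.inf_rel h).1, hγ' s t (Congruence.inf_rel h).2⟩) hn
  simp only [realize_rep_mk _ hA, Term.realize_var] at key
  exact key

theorem Dist.mono {m n k : ℕ} (h : Dist E m n) (hnk : n ≤ k) : Dist E m k :=
  fun A _ hA α β γ a b hab =>
    altComp_mono (Congruence.equivalence_inf α β).refl (Congruence.equivalence_inf α γ).refl hnk
      (h A hA α β γ a b hab)

theorem Dist.distConv {m n : ℕ} (h : Dist E m n) : DistConv E m (n + 1) :=
  fun A _ hA α β γ a b hab =>
    altComp_swap (Congruence.equivalence_inf α γ).refl (h A hA α β γ a b hab)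

theorem Dist.of_succ {m n : ℕ} (h : Dist E (m + 1) n) : Dist E m n :=
  fun A _ hA α β γ a b hab =>
    h A hA α β γ a b ⟨hab.1, altComp_succ_of β.iseqv.refl γ.iseqv.refl hab.2⟩

/-! ### Bounds from Gumm terms -/

/-- Gumm terms reduce `α(β ∘ γ ∘ β)` to `α(γ ∘ β)` followed by an alternating chain. -/
theorem HasGummTerms.exists_chain {k : ℕ} (hk : HasGummTerms E k) {A : Type u} [L.Structure A]
    (hA : Models E A) (α β γ : Congruence L A) {a d : A} (h : (α.r ⊓ altComp β.r γ.r 3) a d) :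
    ∃ e, (α.r ⊓ altComp γ.r β.r 2) a e ∧
      altComp (α.r ⊓ γ.r) (α.r ⊓ β.r) (2 * k) e d := by
  obtain ⟨had, b, hab, c, hbc, d, hcd, rfl⟩ := h
  obtain ⟨p, j, H⟩ := hk
  have ra := α.iseqv.refl
  have rb := β.iseqv.refl
  have rc := γ.iseqv.refl
  have hj : ∀ i, 1 ≤ i → i ≤ k + 1 → ∀ s, α.r a ((j i).realize ![a, s, d]) := by
    intro i h1 h2 s
    have := α.realize_rel_three (j i) (ra a) (ra s) had
    rwa [← (H A hA a s d).2.2.1 i h1 h2] at this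
  have hjαβ : ∀ i, 1 ≤ i → i ≤ k + 1 → ∀ s t, β.r s t →
      (α.r ⊓ β.r) ((j i).realize ![a, s, d]) ((j i).realize ![a, t, d]) :=
    fun i h1 h2 s t hst => ⟨α.iseqv.trans (α.iseqv.symm (hj i h1 h2 s)) (hj i h1 h2 t),
      β.realize_rel_three (j i) (rb a) hst (rb d)⟩
  have hjαγ : ∀ i, 1 ≤ i → i ≤ k + 1 → ∀ s t, γ.r s t →
      (α.r ⊓ γ.r) ((j i).realize ![a, s, d]) ((j i).realize ![a, t, d]) :=
    fun i h1 h2 s t hst => ⟨α.iseqv.trans (α.iseqv.symm (hj i h1 h2 s)) (hj i h1 h2 t),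
      γ.realize_rel_three (j i) (rc a) hst (rc d)⟩
  have eβ := Congruence.equivalence_inf α β
  -- `a = p(a,b,b) γ p(a,b,c) β p(a,a,d) = j₁(a,a,d) β j₁(a,b,d)`.
  refine ⟨(j 1).realize ![a, b, d], ⟨hj 1 le_rfl (by omega) b, p.realize ![a, b, c], ?_,
    (j 1).realize ![a, b, d], ?_, rfl⟩, ?_⟩
  · have := γ.realize_rel_three p (rc a) (rc b) hbc
    rwa [← (H A hA a a b).1] at this
  · have := β.realize_rel_three p (rb a) (β.iseqv.symm hab) hcd
    rw [(H A hA a a d).2.1] at this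
    exact β.iseqv.trans this (hjαβ 1 le_rfl (by omega) a b hab).2
  -- Each index costs two factors: a `γ`-step between `b` and `c` in the middle argument, then a
  -- `β`-step through `d` or `a`, where consecutive `j`s agree.
  · have key : ∀ i, i ≤ k → altComp (α.r ⊓ γ.r) (α.r ⊓ β.r) (2 * i)
        ((j 1).realize ![a, b, d])
        ((j (i + 1)).realize ![a, if Even i then b else c, d]) := by
      intro i
      induction i with
      | zero => intro _; simp [altComp]
      | succ i ih =>
        intro hi
        refine altComp_append (n := 2 * i) (k := 2) (ih (by omega)) ?_
        have h1 := hjαγ (i + 1) (by omega) (by omega)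
        have h2 := hjαβ (i + 1) (by omega) (by omega)
        have h3 := hjαβ (i + 1 + 1) (by omega) (by omega)
        by_cases hev : Even i
        · have e := (H A hA a a d).2.2.2.2.1 (i + 1) (by omega) (by omega) hev.add_one
          simp only [Nat.even_add_one, hev, even_two_mul, if_true, not_true, if_false]
          refine ⟨_, h1 b c hbc, _, eβ.trans (h2 c d hcd) ?_, rfl⟩
          rw [e]
          exact h3 d c (β.iseqv.symm hcd)
        · have e := (H A hA a a d).2.2.2.1 (i + 1) (by omega) (by omega)
            (Nat.even_add_one.2 hev)
          simp only [Nat.even_add_one, hev, even_two_mul, if_true, not_false_eq_true, if_false]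
          refine ⟨_, h1 c b (γ.iseqv.symm hbc), _, eβ.trans (h2 b a (β.iseqv.symm hab)) ?_, rfl⟩
          rw [e]
          exact h3 a b hab
    have := key k le_rfl
    rwa [(H A hA _ _ _).2.2.2.2.2] at this

/-- The first block has `N + 1` factors starting with `αβ`. For even `N` it ends in `αβ` and the
`αγ`-chain follows directly; for odd `N` two `αγ` factors would merge, a saving not needed here. -/
theorem HasGummTerms.dist_three {k N : ℕ} (hk : HasGummTerms E k)
    (hN : DistConv E 2 (N + 1)) : Dist E 3 (N + 2 * k + 1) := by
  intro A _ hA α β γ a d h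
  obtain ⟨e, hae, hed⟩ := hk.exists_chain hA α β γ h
  have hae' := hN A hA α γ β a e hae
  have eβ := Congruence.equivalence_inf α β
  have eγ := Congruence.equivalence_inf α γ
  by_cases hev : Even N
  · rw [show N + 2 * k + 1 = N + 1 + 2 * k by omega]
    exact altComp_append hae' (by simpa [Nat.even_add_one, hev] using hed)
  · cases k with
    | zero => cases hed; exact hae'
    | succ k =>
      refine altComp_mono eβ.refl eγ.refl (by omega) (altComp_append_merge (k := 2 * k + 1)
        eβ eγ hae' ?_)
      simpa [hev, mul_add] using hed

theorem HasGummTerms.dist_three_of_odd {k N : ℕ} (hk : HasGummTerms E (k + 1)) (hodd : Odd N)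
    (hN : DistConv E 2 (N + 1)) : Dist E 3 (N + 2 * k + 2) := by
  intro A _ hA α β γ a d h
  obtain ⟨e, hae, hed⟩ := hk.exists_chain hA α β γ h
  have hae' := hN A hA α γ β a e hae
  rw [show N + 2 * k + 2 = N + 1 + (2 * k + 1) by omega]
  refine altComp_append_merge (Congruence.equivalence_inf α β)
    (Congruence.equivalence_inf α γ) hae' ?_
  simpa [Nat.not_even_iff_odd.2 hodd, mul_add] using hed

/-- Here the first block starts with `αγ`, so the parities are reversed: the junction merges for
even `N`. -/
theorem HasGummTerms.distConv_three {k N : ℕ} (hk : HasGummTerms E k)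
    (hN : Dist E 2 (N + 1)) : DistConv E 3 (N + 2 * k + 1) := by
  intro A _ hA α β γ a d h
  obtain ⟨e, hae, hed⟩ := hk.exists_chain hA α β γ h
  rw [show N + 2 * k + 1 = N + 1 + 2 * k by omega]
  exact altComp_append_of_equivalence (Congruence.equivalence_inf α γ)
    (Congruence.equivalence_inf α β) (hN A hA α γ β a e hae) hed

theorem HasGummTerms.distConv_three_of_even {k N : ℕ} (hk : HasGummTerms E (k + 1))
    (heven : Even N) (hN : Dist E 2 (N + 1)) : DistConv E 3 (N + 2 * k + 2) := by
  intro A _ hA α β γ a d h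
  obtain ⟨e, hae, hed⟩ := hk.exists_chain hA α β γ h
  have hae' := hN A hA α γ β a e hae
  rw [show N + 2 * k + 2 = N + 1 + (2 * k + 1) by omega]
  refine altComp_append_merge (Congruence.equivalence_inf α γ)
    (Congruence.equivalence_inf α β) hae' ?_
  simpa [heven, mul_add] using hed

/-! ### Day terms and Gumm terms from modularity -/

/-- The quaternary terms `u₀, …, uₘ` satisfy Day's identities in the variety. -/
structure IsDayTerms (E : Set (L.Term ℕ × L.Term ℕ)) (m : ℕ) (u : ℕ → L.Term (Fin 4)) :
    Prop where
  first : ∀ (A : Type u) [L.Structure A], Models E A → ∀ a b c d : A,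
    (u 0).realize ![a, b, c, d] = a
  last : ∀ (A : Type u) [L.Structure A], Models E A → ∀ a b c d : A,
    (u m).realize ![a, b, c, d] = d
  idem : ∀ (A : Type u) [L.Structure A], Models E A → ∀ a b : A, ∀ i ≤ m,
    (u i).realize ![a, b, b, a] = a
  even : ∀ (A : Type u) [L.Structure A], Models E A → ∀ a d : A, ∀ i < m, Even i →
    (u i).realize ![a, a, d, d] = (u (i + 1)).realize ![a, a, d, d]
  odd : ∀ (A : Type u) [L.Structure A], Models E A → ∀ a b d : A, ∀ i < m, Odd i →
    (u i).realize ![a, b, b, d] = (u (i + 1)).realize ![a, b, b, d]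

-- Modularity is applied to the generic quadruple. The condition `v 1 = v 2` is included in `α`
-- because the middle pair must lie in `αγ`.
open Free in
theorem IsModular.exists_isDayTerms {m : ℕ} (hm : IsModular E m) :
    ∃ u, IsDayTerms E m u := by
  let α : Congruence L (Free E (Fin 4)) := kerCong fun v => v 0 = v 3 ∧ v 1 = v 2
  let β : Congruence L (Free E (Fin 4)) := kerCong fun v => v 0 = v 1 ∧ v 2 = v 3
  let γ : Congruence L (Free E (Fin 4)) := kerCong fun v => v 1 = v 2
  obtain ⟨w, hw0, hwm, hw⟩ := exists_seq_of_altComp (hm _ models α β γ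
    (mk (Term.var 0)) (mk (Term.var 3))
    ⟨kerCong_var fun _ _ h => h.1, _, kerCong_var fun _ _ h => h.1, mk (Term.var 2),
      ⟨kerCong_var fun _ _ h => h.2, kerCong_var fun _ _ h => h⟩, kerCong_var fun _ _ h => h.2⟩)
  have first : ∀ (A : Type u) [L.Structure A], Models E A → ∀ a b c d : A,
      (w 0).rep.realize ![a, b, c, d] = a := by
    intro A _ hA a b c d
    rw [hw0, realize_rep_mk _ hA]; rfl
  refine ⟨fun i => (w i).rep, first, ?_, ?_, ?_, ?_⟩
  · intro A _ hA a b c d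
    rw [hwm, realize_rep_mk _ hA]; rfl
  · intro A _ hA a b i
    induction i with
    | zero => intro _; exact first A hA a b b a
    | succ i ih =>
      intro hi
      have h : α.r (w i) (w (i + 1)) := by
        rcases Nat.even_or_odd i with h | h
        · exact ((hw i hi).1 h).1
        · exact ((hw i hi).2 h).1
      exact (h A hA ![a, b, b, a] ⟨rfl, rfl⟩).symm.trans (ih (by omega))
  · intro A _ hA a d i hi hev
    exact ((hw i hi).1 hev).2 A hA _ ⟨rfl, rfl⟩
  · intro A _ hA a b d i hi hodd
    exact ((hw i hi).2 hodd).2 A hA _ rfl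

/-- Induction along the Day terms: `t = uᵢ₊₂`, applied as `t(·,s,r,·)`, carries the old chain to one
ending at `t(w,s,r,w)`, where `w` is its old endpoint. Modularity joins this to the next endpoint in
`m` factors; one more allows for alignment. -/
theorem IsDayTerms.exists_chain {m : ℕ} {u : ℕ → L.Term (Fin 4)} (hu : IsDayTerms E m u)
    (hm : IsModular E m) {A : Type u} [L.Structure A] (hA : Models E A) (α β γ : Congruence L A)
    {x y z : A} (hxz : α.r x z) (hxy : β.r x y) (hyz : γ.r y z) (i : ℕ) (hi : i + 1 < m) :
    ∃ p e, γ.r x p ∧ β.r p e ∧ altComp (α.r ⊓ γ.r) (α.r ⊓ β.r) ((m + 1) * i) e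
      ((u (i + 1)).realize ![x, x, if Even i then x else z, z]) := by
  have ra := α.iseqv.refl
  have rb := β.iseqv.refl
  have rc := γ.iseqv.refl
  have sa : ∀ {a b}, α.r a b → α.r b a := α.iseqv.symm
  have sb : ∀ {a b}, β.r a b → β.r b a := β.iseqv.symm
  have sc : ∀ {a b}, γ.r a b → γ.r b a := γ.iseqv.symm
  have eβ := Congruence.equivalence_inf α β
  have eγ := Congruence.equivalence_inf α γ
  induction i with
  | zero =>
    refine ⟨(u 1).realize ![x, x, y, z], (u 1).realize ![x, x, x, z], ?_,
      β.realize_rel_four _ (rb x) (rb x) (sb hxy) (rb z), by simp [altComp]⟩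
    have := γ.realize_rel_four (u 1) (rc x) (rc x) (sc hyz) (rc z)
    rwa [← hu.even A hA x z 0 (by omega) Even.zero, hu.first A hA] at this
  | succ i ih =>
    obtain ⟨p, e, hxp, hpe, hpath⟩ := ih (by omega)
    set t := u (i + 1 + 1) with ht
    have idem : ∀ a b, t.realize ![a, b, b, a] = a := fun a b => hu.idem A hA a b _ hi.le
    have hmap : ∀ s r, altComp (α.r ⊓ γ.r) (α.r ⊓ β.r) ((m + 1) * i) (t.realize ![e, s, r, e])
        (t.realize ![(u (i + 1)).realize ![x, x, if Even i then x else z, z], s, r,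
          (u (i + 1)).realize ![x, x, if Even i then x else z, z] ]) := fun s r =>
      altComp_map (f := fun a => t.realize ![a, s, r, a])
        (fun a b h => ⟨α.realize_rel_four t h.1 (ra s) (ra r) h.1,
          γ.realize_rel_four t h.2 (rc s) (rc r) h.2⟩)
        (fun a b h => ⟨α.realize_rel_four t h.1 (ra s) (ra r) h.1,
          β.realize_rel_four t h.2 (rb s) (rb r) h.2⟩) hpath
    rw [show (m + 1) * (i + 1) = (m + 1) * i + (m + 1) by ring]
    by_cases hev : Even i
    · have hv := hu.odd A hA x x z (i + 1) (by omega) hev.add_one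
      simp only [hev, if_true] at hmap
      simp only [Nat.even_add_one, hev, not_true, if_false]
      rw [hv, ← ht] at hmap
      set w := t.realize ![x, x, x, z] with hw
      have hwx : α.r w x := by
        have := α.realize_rel_four t (ra x) (ra x) (ra x) (sa hxz)
        rwa [idem] at this
      refine ⟨t.realize ![p, y, z, p], t.realize ![e, x, z, e], ?_,
        β.realize_rel_four t hpe (sb hxy) (rb z) hpe,
        altComp_append_of_equivalence eγ eβ (hmap x z) ?_⟩
      · have := γ.realize_rel_four t (rc p) (sc hyz) (rc z) (rc p)
        rw [idem] at this
        exact γ.iseqv.trans hxp this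
      -- Modularity with `β` and `γ` exchanged. The middle link is `t(w,x,y,w) β t(w,x,x,w) = w =
      -- t(x,x,x,z) β t(x,x,y,z)`.
      · refine altComp_succ_of eγ.refl eβ.refl (hm A hA α γ β _ _ ⟨?_, t.realize ![w, x, y, w],
          γ.realize_rel_four t (rc w) (rc x) (sc hyz) (rc w), t.realize ![x, x, y, z], ⟨?_, ?_⟩,
          γ.realize_rel_four t (rc x) (rc x) hyz (rc z)⟩)
        · exact α.realize_rel_four t hwx (ra x) (ra z) (α.iseqv.trans hwx hxz)
        · exact α.realize_rel_four t hwx (ra x) (ra y) (α.iseqv.trans hwx hxz)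
        · have h1 := β.realize_rel_four t (rb w) (rb x) (sb hxy) (rb w)
          rw [idem] at h1
          exact β.iseqv.trans h1 (β.realize_rel_four t (rb x) (rb x) hxy (rb z))
    · have hv := hu.even A hA x z (i + 1) (by omega) (Nat.even_add_one.2 hev)
      simp only [hev, if_false] at hmap
      simp only [Nat.even_add_one, hev, not_false_eq_true, if_true]
      rw [hv, ← ht] at hmap
      set w := t.realize ![x, x, z, z] with hw
      have hwx : α.r w x := by
        have := α.realize_rel_four t (ra x) (ra x) (sa hxz) (sa hxz)
        rwa [idem] at this
      refine ⟨t.realize ![p, z, y, p], t.realize ![e, z, x, e], ?_,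
        β.realize_rel_four t hpe (rb z) (sb hxy) hpe,
        altComp_append_of_equivalence eγ eβ (hmap z x) ?_⟩
      · have := γ.realize_rel_four t (rc p) (rc z) hyz (rc p)
        rw [idem] at this
        exact γ.iseqv.trans hxp (sc this)
      -- Modularity gives a chain starting with `αβ`; a trivial `αγ` factor is put in front. The
      -- middle link is `t(w,z,y,w) γ t(w,z,z,w) = w = t(x,x,z,z) γ t(x,x,y,z)`.
      · refine altComp_swap eγ.refl (hm A hA α β γ _ _ ⟨?_, t.realize ![w, z, y, w],
          β.realize_rel_four t (rb w) (rb z) hxy (rb w), t.realize ![x, x, y, z], ⟨?_, ?_⟩,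
          β.realize_rel_four t (rb x) (rb x) (sb hxy) (rb z)⟩)
        · exact α.realize_rel_four t hwx (sa hxz) (ra x) (α.iseqv.trans hwx hxz)
        · exact α.realize_rel_four t hwx (sa hxz) (ra y) (α.iseqv.trans hwx hxz)
        · have h1 := γ.realize_rel_four t (rc w) (rc z) hyz (rc w)
          rw [idem] at h1
          exact γ.iseqv.trans h1 (γ.realize_rel_four t (rc x) (rc x) (sc hyz) (rc z))

theorem IsModular.exists_chain {n : ℕ} (hm : IsModular E (n + 2)) {A : Type u} [L.Structure A]
    (hA : Models E A) (α β γ : Congruence L A) {x y z : A} (hxz : α.r x z) (hxy : β.r x y)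
    (hyz : γ.r y z) :
    ∃ p e, γ.r x p ∧ β.r p e ∧ altComp (α.r ⊓ γ.r) (α.r ⊓ β.r) ((n + 3) * n) e z := by
  obtain ⟨u, hu⟩ := hm.exists_isDayTerms
  have h := hu.exists_chain hm hA α β γ hxz hxy hyz n (by omega)
  rcases Nat.even_or_odd n with hn | hn
  · simp only [hn, if_true] at h
    rwa [hu.odd A hA x x z (n + 1) (by omega) hn.add_one, hu.last A hA] at h
  · simp only [Nat.not_even_iff_odd.2 hn, if_false] at h
    rwa [hu.even A hA x z (n + 1) (by omega) hn.add_one, hu.last A hA] at h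

open Free in
/-- Day's terms yield Gumm terms. -/
theorem IsModular.hasGummTerms {n : ℕ} (hm : IsModular E (n + 2)) :
    HasGummTerms E ((n + 3) * n) := by
  let α : Congruence L (Free E (Fin 3)) := kerCong fun v => v 0 = v 2
  let β : Congruence L (Free E (Fin 3)) := kerCong fun v => v 0 = v 1
  let γ : Congruence L (Free E (Fin 3)) := kerCong fun v => v 1 = v 2
  have hα : α.r (mk (Term.var 0)) (mk (Term.var 2)) := kerCong_var fun _ _ h => h
  obtain ⟨p, e, hxp, hpe, hpath⟩ := hm.exists_chain models α β γ hα
    (y := mk (Term.var 1)) (kerCong_var fun _ _ h => h) (kerCong_var fun _ _ h => h)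
  obtain ⟨w, rfl, hwk, hw⟩ := exists_seq_of_altComp hpath
  -- The `α`-class of `w 0` is found from the far end: the chain lies in `α` and ends at the third
  -- generator.
  have hα0 : α.r (mk (Term.var 0)) (w 0) :=
    α.iseqv.trans hα (α.iseqv.symm
      (rel_of_altComp α.iseqv (fun _ _ h => h.1) (fun _ _ h => h.1) hpath))
  have hαw : ∀ i ≤ (n + 3) * n, α.r (mk (Term.var 0)) (w i) := by
    intro i
    induction i with
    | zero => intro _; exact hα0
    | succ i ih =>
      intro hi
      refine α.iseqv.trans (ih (by omega)) ?_
      rcases Nat.even_or_odd i with h | h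
      · exact ((hw i hi).1 h).1
      · exact ((hw i hi).2 h).1
  -- The `j`s are indexed from 1 and the chain from 0, so parities flip: odd `i` corresponds to an
  -- `αγ` factor.
  refine ⟨p.rep, fun i => (w (i - 1)).rep, fun A _ hA x y z => ⟨?_, ?_, ?_, ?_, ?_, ?_⟩⟩
  · have := hxp A hA ![x, z, z] rfl
    rwa [realize_rep_mk _ hA] at this
  · exact hpe A hA ![x, x, z] rfl
  · intro i h1 h2
    have := hαw (i - 1) (by omega) A hA ![x, y, x] rfl
    rwa [realize_rep_mk _ hA] at this
  · intro i h1 h2 hev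
    obtain ⟨i, rfl⟩ : ∃ l, i = l + 1 := ⟨i - 1, by omega⟩
    rw [Nat.even_add_one, Nat.not_even_iff_odd] at hev
    exact ((hw i (by omega)).2 hev).2 A hA ![x, x, z] rfl
  · intro i h1 h2 hodd
    obtain ⟨i, rfl⟩ : ∃ l, i = l + 1 := ⟨i - 1, by omega⟩
    rw [Nat.odd_add_one, Nat.not_odd_iff_even] at hodd
    exact ((hw i (by omega)).1 hodd).2 A hA ![x, z, z] rfl
  · change (w ((n + 3) * n)).rep.realize ![x, y, z] = z
    rw [hwk, realize_rep_mk _ hA]; rfl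

end UnivAlg

/-! ### The main theorem -/

theorem theorem4p2 {L : FirstOrder.Language.{u, v}} [L.IsAlgebraic]
    (E : Set (L.Term ℕ × L.Term ℕ)) (hE : UnivAlg.CongruenceDistributive E) :
    -- the four values of the spectra are well defined, as minima of nonempty sets
    (IsLeast {k | UnivAlg.Dist E 2 (k + 1)} (UnivAlg.J E 1) ∧
      IsLeast {k | UnivAlg.DistConv E 2 (k + 1)} (UnivAlg.JConv E 1) ∧
      IsLeast {k | UnivAlg.Dist E 3 (k + 1)} (UnivAlg.J E 2) ∧
      IsLeast {k | UnivAlg.DistConv E 3 (k + 1)} (UnivAlg.JConv E 2)) ∧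
    (∀ m : ℕ, 2 ≤ m → UnivAlg.IsModular E m →
      (UnivAlg.J E 2 : ℤ) ≤ UnivAlg.JConv E 1 + 2 * (m : ℤ) ^ 2 - 2 * m - 2 ∧
      (UnivAlg.JConv E 2 : ℤ) ≤ UnivAlg.J E 1 + 2 * (m : ℤ) ^ 2 - 2 * m - 2) ∧
    (∀ k : ℕ, UnivAlg.HasGummTerms E k →
      (UnivAlg.J E 2 : ℤ) ≤ UnivAlg.JConv E 1 + 2 * (k : ℤ) ∧
      (UnivAlg.JConv E 2 : ℤ) ≤ UnivAlg.J E 1 + 2 * (k : ℤ) ∧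
      (1 ≤ k → Odd (UnivAlg.JConv E 1) →
        (UnivAlg.J E 2 : ℤ) ≤ UnivAlg.JConv E 1 + 2 * (k : ℤ) - 1) ∧
      (1 ≤ k → Even (UnivAlg.J E 1) →
        (UnivAlg.JConv E 2 : ℤ) ≤ UnivAlg.J E 1 + 2 * (k : ℤ) - 1)) := by
  obtain ⟨n, hn⟩ := hE.exists_dist_three
  have l1 : IsLeast {k | UnivAlg.Dist E 2 (k + 1)} (UnivAlg.J E 1) :=
    ⟨Nat.sInf_mem (s := {k | UnivAlg.Dist E 2 (k + 1)}) ⟨n, hn.of_succ.mono n.le_succ⟩,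
      fun _ => Nat.sInf_le⟩
  have l2 : IsLeast {k | UnivAlg.DistConv E 2 (k + 1)} (UnivAlg.JConv E 1) :=
    ⟨Nat.sInf_mem (s := {k | UnivAlg.DistConv E 2 (k + 1)}) ⟨n, hn.of_succ.distConv⟩,
      fun _ => Nat.sInf_le⟩
  have l3 : IsLeast {k | UnivAlg.Dist E 3 (k + 1)} (UnivAlg.J E 2) :=
    ⟨Nat.sInf_mem (s := {k | UnivAlg.Dist E 3 (k + 1)}) ⟨n, hn.mono n.le_succ⟩,
      fun _ => Nat.sInf_le⟩
  have l4 : IsLeast {k | UnivAlg.DistConv E 3 (k + 1)} (UnivAlg.JConv E 2) :=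
    ⟨Nat.sInf_mem (s := {k | UnivAlg.DistConv E 3 (k + 1)}) ⟨n, hn.distConv⟩,
      fun _ => Nat.sInf_le⟩
  have gumm : ∀ k, UnivAlg.HasGummTerms E k →
      UnivAlg.J E 2 ≤ UnivAlg.JConv E 1 + 2 * k ∧ UnivAlg.JConv E 2 ≤ UnivAlg.J E 1 + 2 * k :=
    fun k hk => ⟨l3.2 (hk.dist_three l2.1), l4.2 (hk.distConv_three l1.1)⟩
  refine ⟨⟨l1, l2, l3, l4⟩, fun m hm hmod => ?_, fun k hk => ?_⟩
  · obtain ⟨m, rfl⟩ := Nat.exists_eq_add_of_le' hm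
    obtain ⟨h1, h2⟩ := gumm _ hmod.hasGummTerms
    -- With `m + 2` for the modularity index, `2k = 2(m + 3)m` is two less than the claimed
    -- increment.
    zify at h1 h2
    push_cast
    constructor <;> linarith
  · obtain ⟨h1, h2⟩ := gumm k hk
    refine ⟨by exact_mod_cast h1, by exact_mod_cast h2, fun hk1 hodd => ?_, fun hk1 heven => ?_⟩
    · obtain ⟨k, rfl⟩ := Nat.exists_eq_add_of_le' hk1
      have h : UnivAlg.J E 2 ≤ UnivAlg.JConv E 1 + 2 * k + 1 :=
        l3.2 (hk.dist_three_of_odd hodd l2.1)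
      push_cast
      omega
    · obtain ⟨k, rfl⟩ := Nat.exists_eq_add_of_le' hk1
      have h : UnivAlg.JConv E 2 ≤ UnivAlg.J E 1 + 2 * k + 1 :=
        l4.2 (hk.distConv_three_of_even heven l1.1)
      push_cast
      omega
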